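/- Let $G$ be a connected graph. A ray in $G$ is a one-way infinite path; two rays are equivalent if no finite set of vertices separates them in $G$, and the ends of $G$ are the equivalence classes of rays. For a finite set $X\subseteq V(G)$ and an end $\omega$, let $C(X,\omega)$ be the component of $G-X$ that contains a tail of every ray in $\omega$. The set $\Omega(G)$ of ends carries the topology whose basis consists of the sets $\{\omega\in\Omega(G) : C(X,\omega)=C\}$, where $X\subseteq V(G)$ is finite and $C$ is a component of $G-X$. For a subgraph $H\subseteq G$ let $\partial_\Omega H$ be the set of ends $\omega$ of $G$ such that $C(X,\omega)\cap H\neq\emptyset$ for every finite $X\subseteq V(G)$; call $H$ end-faithful if the natural map $\Omega(H)\to\Omega(G)$, which sends the class in $H$ of a ray of $H$ to its class in $G$, is a bijection. A rooted tree $T\subseteq G$ with root $r$ is normal in $G$ if the endvertices of every $T$-path in $G$ (a path with at least one edge that meets $T$ exactly in its two endvertices) are comparable in the tree-order of $T$, where $u\le v$ means that $u$ lies on the path from $r$ to $v$ in $T$. **Theorem.** Suppose that every end $\omega$ of $G$ has a local end-faithful normal tree, that is, for every end $\omega$ of $G$ there is a normal (rooted) tree $T$ in $G$ such that $\partial_\Omega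 T$ is a neighbourhood of $\omega$ in $\Omega(G)$. Then $G$ has an end-faithful normal tree. -/

import Mathlib

open Topology

namespace SimpleGraph

/-- A ray of `G`: a one-way infinite path `v₀ v₁ v₂ …` in `G`. -/
structure Ray {V : Type*} (G : SimpleGraph V) where
  /-- The vertices of the ray in their order along the ray. -/
  vert : ℕ → V
  injective : Function.Injective vert
  adj : ∀ n, G.Adj (vert n) (vert (n + 1))

/-- Two rays are equivalent if no finite set `X` of vertices separates them, that is, for every
finite `X` some component of `G - X` contains a vertex of each of them. -/
def Ray.Equivalent {V : Type*} {G : SimpleGraph V} (R S : G.Ray) : Prop :=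
  ∀ X : Finset V, ∃ (i j : ℕ) (hi : R.vert i ∉ (X : Set V)) (hj : S.vert j ∉ (X : Set V)),
    G.componentComplMk hi = G.componentComplMk hj

theorem Ray.exists_tail_avoids {V : Type*} {G : SimpleGraph V} (R : G.Ray) (X : Finset V) :
    ∃ N, ∀ n, N ≤ n → R.vert n ∉ (X : Set V) := by
  have hfin : (R.vert ⁻¹' (X : Set V)).Finite := X.finite_toSet.preimage R.injective.injOn
  obtain ⟨B, hB⟩ := hfin.bddAbove
  refine ⟨B + 1, fun n hn hmem => ?_⟩
  have := hB hmem
  omega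

theorem Ray.exists_tail_component {V : Type*} {G : SimpleGraph V} (R : G.Ray) (X : Finset V) :
    ∃ C : G.ComponentCompl (X : Set V), ∃ N, ∀ n, N ≤ n → R.vert n ∈ C := by
  obtain ⟨N, hN⟩ := R.exists_tail_avoids X
  refine ⟨G.componentComplMk (hN N le_rfl), N, fun n hn => ?_⟩
  induction n, hn using Nat.le_induction with
  | base => exact G.componentComplMk_mem _
  | succ n hn ih =>
    obtain ⟨h, e⟩ := ih
    exact ⟨hN (n + 1) (by omega),
      (G.componentComplMk_eq_of_adj (hN (n + 1) (by omega)) h (R.adj n).symm).trans e⟩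

/-- The component of `G - X` that contains a tail of the ray `R`, for a finite set `X`. -/
noncomputable def Ray.tailComponent {V : Type*} {G : SimpleGraph V} (R : G.Ray) (X : Finset V) :
    G.ComponentCompl (X : Set V) :=
  (R.exists_tail_component X).choose

theorem Ray.tailComponent_spec {V : Type*} {G : SimpleGraph V} (R : G.Ray) (X : Finset V) :
    ∃ N, ∀ n, N ≤ n → R.vert n ∈ R.tailComponent X :=
  (R.exists_tail_component X).choose_spec

theorem Ray.tailComponent_eq {V : Type*} {G : SimpleGraph V} (R : G.Ray) (X : Finset V)
    {C : G.ComponentCompl (X : Set V)} {N : ℕ} (h : ∀ n, N ≤ n → R.vert n ∈ C) :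
    R.tailComponent X = C := by
  obtain ⟨M, hM⟩ := R.tailComponent_spec X
  obtain ⟨_, e⟩ := hM (max M N) (le_max_left _ _)
  obtain ⟨_, e'⟩ := h (max M N) (le_max_right _ _)
  exact e.symm.trans e'

theorem Ray.equivalent_iff {V : Type*} {G : SimpleGraph V} {R S : G.Ray} :
    R.Equivalent S ↔ ∀ X : Finset V, R.tailComponent X = S.tailComponent X := by
  classical
  constructor
  · intro h X
    obtain ⟨M, hM⟩ := R.tailComponent_spec X
    obtain ⟨N, hN⟩ := S.tailComponent_spec X
    obtain ⟨i, j, hi, hj, e⟩ :=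
      h (X ∪ (Finset.range M).image R.vert ∪ (Finset.range N).image S.vert)
    have hXY : (X : Set V) ⊆
        ↑(X ∪ (Finset.range M).image R.vert ∪ (Finset.range N).image S.vert) := by
      intro x hx
      simp only [Finset.coe_union, Set.mem_union]
      exact Or.inl (Or.inl hx)
    have hiM : M ≤ i := by
      by_contra hlt
      apply hi
      simp only [Finset.coe_union, Set.mem_union, Finset.coe_image, Set.mem_image]
      exact Or.inl (Or.inr ⟨i, by simpa using hlt, rfl⟩)
    have hjN : N ≤ j := by
      by_contra hlt
      apply hj
      simp only [Finset.coe_union, Set.mem_union, Finset.coe_image, Set.mem_image]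
      exact Or.inr ⟨j, by simpa using hlt, rfl⟩
    obtain ⟨hi', ei⟩ := hM i hiM
    obtain ⟨hj', ej⟩ := hN j hjN
    rw [← ei, ← ej]
    have := congrArg (ComponentCompl.hom hXY) e
    exact this
  · intro h X
    obtain ⟨M, hM⟩ := R.tailComponent_spec X
    obtain ⟨N, hN⟩ := S.tailComponent_spec X
    obtain ⟨hi, ei⟩ := hM M le_rfl
    obtain ⟨hj, ej⟩ := hN N le_rfl
    exact ⟨M, N, hi, hj, by rw [ei, ej, h X]⟩

/-- Equivalence of rays. -/
instance raySetoid {V : Type*} (G : SimpleGraph V) : Setoid G.Ray where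
  r := Ray.Equivalent
  iseqv :=
    { refl := fun _ => Ray.equivalent_iff.2 fun _ => rfl
      symm := fun h => Ray.equivalent_iff.2 fun X => (Ray.equivalent_iff.1 h X).symm
      trans := fun h h' => Ray.equivalent_iff.2 fun X =>
        (Ray.equivalent_iff.1 h X).trans (Ray.equivalent_iff.1 h' X) }

/-- The set `Ω(G)` of ends of `G`: the equivalence classes of rays. -/
def EndSpace {V : Type*} (G : SimpleGraph V) : Type _ :=
  Quotient (raySetoid G)

/-- `C(X, ω)`: the component of `G - X` that contains a tail of every ray in the end `ω`. -/
noncomputable def EndSpace.component {V : Type*} {G : SimpleGraph V} (X : Finset V)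
    (ω : G.EndSpace) : G.ComponentCompl (X : Set V) :=
  Quotient.lift (fun R : G.Ray => R.tailComponent X)
    (fun _ _ h => Ray.equivalent_iff.1 h X) ω

/-- The topology on `Ω(G)` with basis the sets `Ω(X, C) = {ω | C(X, ω) = C}`, where `X` is a
finite set of vertices and `C` is a component of `G - X`. -/
instance EndSpace.instTopologicalSpace {V : Type*} (G : SimpleGraph V) :
    TopologicalSpace G.EndSpace :=
  TopologicalSpace.generateFrom
    {U | ∃ (X : Finset V) (C : G.ComponentCompl (X : Set V)), U = {ω | ω.component X = C}}

namespace Subgraph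

/-- A ray of a subgraph, as a ray of the whole graph. -/
def mapRay {V : Type*} {G : SimpleGraph V} (H : G.Subgraph) (R : H.coe.Ray) : G.Ray where
  vert n := (R.vert n : V)
  injective := Subtype.val_injective.comp R.injective
  adj n := H.adj_sub (R.adj n)

theorem mapRay_equivalent {V : Type*} {G : SimpleGraph V} (H : G.Subgraph) {R S : H.coe.Ray}
    (h : R.Equivalent S) : (H.mapRay R).Equivalent (H.mapRay S) := by
  classical
  intro X
  obtain ⟨i, j, hi, hj, e⟩ := h (X.preimage (Subtype.val : H.verts → V)
    Subtype.val_injective.injOn)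
  have hi' : (H.mapRay R).vert i ∉ (X : Set V) := fun hx => hi (by simpa using (show (R.vert i : V) ∈ (X : Set V) from hx))
  have hj' : (H.mapRay S).vert j ∉ (X : Set V) := fun hx => hj (by simpa using (show (S.vert j : V) ∈ (X : Set V) from hx))
  refine ⟨i, j, hi', hj', ?_⟩
  have hmaps : Set.MapsTo H.hom
      ((X.preimage (Subtype.val : H.verts → V) Subtype.val_injective.injOn : Finset H.verts) :
        Set H.verts)ᶜ ((X : Set V))ᶜ := by
    intro v hv hx
    exact hv (by simpa using hx)
  exact congrArg (ConnectedComponent.map (induceHom H.hom hmaps)) e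

/-- The natural map `Ω(H) → Ω(G)` for a subgraph `H` of `G`: the class of a ray in `H` is sent to
its class in `G`. -/
def endMap {V : Type*} {G : SimpleGraph V} (H : G.Subgraph) : H.coe.EndSpace → G.EndSpace :=
  Quotient.map H.mapRay (fun _ _ h => H.mapRay_equivalent h)

/-- `H` is end-faithful in `G` if the natural map `Ω(H) → Ω(G)` is a bijection. -/
def IsEndFaithful {V : Type*} {G : SimpleGraph V} (H : G.Subgraph) : Prop :=
  Function.Bijective H.endMap

/-- `∂_Ω H`: the set of ends `ω` of `G` such that `C(X, ω)` meets `H` for every finite `X`. -/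
def endBoundary {V : Type*} {G : SimpleGraph V} (H : G.Subgraph) : Set G.EndSpace :=
  {ω | ∀ X : Finset V, ((ω.component X : Set V) ∩ H.verts).Nonempty}

/-- The walk `p` is an `H`-path of `G`: a non-trivial path that meets `H` exactly in its two
endvertices. -/
structure IsPathOutside {V : Type*} {G : SimpleGraph V} (H : G.Subgraph) {u v : V}
    (p : G.Walk u v) : Prop where
  isPath : p.IsPath
  nontrivial : 0 < p.length
  meets_iff : ∀ w ∈ p.support, w ∈ H.verts ↔ w = u ∨ w = v
  edges_notMem : ∀ e ∈ p.edges, e ∉ H.edgeSet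

/-- The tree-order of the tree `T` with root `r`: `u ≤ v` if `u` lies on the path from `r` to `v`
in `T`. -/
def TreeLE {V : Type*} {G : SimpleGraph V} (T : G.Subgraph) (r u v : T.verts) : Prop :=
  ∃ p : T.coe.Walk r v, p.IsPath ∧ u ∈ p.support

/-- `T` with root `r` is a rooted tree contained in `G` that is normal in `G`: the endvertices of
every `T`-path of `G` are comparable in the tree-order of `T`. -/
structure IsNormalTree {V : Type*} {G : SimpleGraph V} (T : G.Subgraph) (r : T.verts) :
    Prop where
  isTree : T.coe.IsTree
  comparable : ∀ (u v : T.verts) (p : G.Walk (u : V) (v : V)), T.IsPathOutside p →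
    T.TreeLE r u v ∨ T.TreeLE r v u

end Subgraph

/-- The end `ω` has a local end-faithful normal tree: a normal tree `T` in `G` such that `∂_Ω T`
is a neighbourhood of `ω` in `Ω(G)`. -/
def EndSpace.HasLocalNormalTree {V : Type*} {G : SimpleGraph V} (ω : G.EndSpace) : Prop :=
  ∃ (T : G.Subgraph) (r : T.verts), T.IsNormalTree r ∧ T.endBoundary ∈ 𝓝 ω

end SimpleGraph

/-!
The proof has two halves, joined by the notion of a normally covered set of vertices: all ends
living in the set are in the closure of one countable union of dispersed sets. The levels of a
normal tree are dispersed (`Subgraph.IsNormalTree.isDispersed_level`), so by hypothesis every end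
`ω` lives in a normally covered `C(X, ω)`.

*From local to global* (`isCovered_univ`). Suppose that `G` is not normally covered. If a component
`D` of `G - X`, with `X` finite, is not normally covered and `a ∈ D`, then neither is some component
of `D - a` (`isCovered_of_forall_compIn`). Hence there is a ray `v 0, v 1, …` that runs through a
decreasing sequence of sets `D k` that are not normally covered, where `D (k + 1)` is a component
of `D k - v k`. For every `p` that has a normally covered component of some `G - X p` around it, fix
such a finite set `X p`. The ray can be chosen so that for every such `p = v m` the set `X p` is
disjoint from some `D k`: each step approaches the first of the sets `X (v 0), X (v 1), …` that still
meets the current component (`IsDepthFirst.exists_disjoint`). Then `p` has no neighbour in that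
`D k`, since otherwise `D k` would lie in a normally covered component of `G - X p`. Now let `ω` be
the end of the ray and `Y` a finite set with `C(Y, ω)` normally covered. No `D k` lies inside
`C(Y, ω)`, so `Y` has a vertex `z` in all `D k`. A path to `z` from a late vertex of the ray first
enters the intersection of all `D k` from some `v j` in `C(Y, ω)`. This `v j` is one of the vertices
`p` above, but it has neighbours in all `D k`, a contradiction.

*From a cover to a tree* (`exists_isNormalTree_isEndFaithful`). Every depth-first search tree is
normal, where a depth-first search visits, in each component left by the vertices visited before
it, a neighbour of the last vertex. If the dispersed sets `U 0, U 1, …` cover `G` normally, let each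
step approach the first `U n` that meets the current component. By the same lemma
`IsDepthFirst.exists_disjoint`, a ray along which the search follows an end `ω` leaves every `U n`
behind, and so it belongs to `ω` (`IsDepthFirst.toEnd_eq`). Thus the natural map on ends is
surjective. It is injective for every normal tree
(`Subgraph.IsNormalTree.endMap_injective`).
-/

namespace SimpleGraph

/-! ### Components of induced subgraphs -/

/-- The vertex set of the component of `G[S]` that contains `z`, for a set `S` of vertices. It is
empty if `z ∉ S`. -/
def compIn {V : Type*} (G : SimpleGraph V) (S : Set V) (z : V) : Set V :=
  {w | ∃ p : G.Walk z w, ∀ x ∈ p.support, x ∈ S}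

section CompIn

variable {V : Type*} {G : SimpleGraph V} {S T : Set V} {a b z w : V}

theorem compIn_subset : G.compIn S z ⊆ S := fun _ ⟨p, hp⟩ => hp _ p.end_mem_support

theorem mem_of_mem_compIn (h : w ∈ G.compIn S z) : z ∈ S := by
  obtain ⟨p, hp⟩ := h
  exact hp _ p.start_mem_support

theorem self_mem_compIn (h : z ∈ S) : z ∈ G.compIn S z := ⟨.nil, by simpa using h⟩

theorem compIn_symm (h : w ∈ G.compIn S z) : z ∈ G.compIn S w := by
  obtain ⟨p, hp⟩ := h
  exact ⟨p.reverse, by simpa using hp⟩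

theorem compIn_trans (h : a ∈ G.compIn S z) (h' : b ∈ G.compIn S a) : b ∈ G.compIn S z := by
  obtain ⟨p, hp⟩ := h
  obtain ⟨q, hq⟩ := h'
  refine ⟨p.append q, fun x hx => ?_⟩
  rcases (Walk.mem_support_append_iff _ _).1 hx with hx | hx
  exacts [hp x hx, hq x hx]

theorem compIn_eq (h : w ∈ G.compIn S z) : G.compIn S w = G.compIn S z :=
  Set.Subset.antisymm (fun _ hx => compIn_trans h hx)
    (fun _ hx => compIn_trans (compIn_symm h) hx)

theorem compIn_mono (h : S ⊆ T) : G.compIn S z ⊆ G.compIn T z :=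
  fun _ ⟨p, hp⟩ => ⟨p, fun x hx => h (hp x hx)⟩

theorem compIn_adj (h : a ∈ G.compIn S z) (hab : G.Adj a b) (hb : b ∈ S) :
    b ∈ G.compIn S z :=
  compIn_trans h ⟨.cons hab .nil, by simp [hb, compIn_subset h]⟩

theorem support_subset_compIn (p : G.Walk z w) (hp : ∀ x ∈ p.support, x ∈ S) :
    ∀ x ∈ p.support, x ∈ G.compIn S z := by
  classical
  exact fun x hx => ⟨p.takeUntil x hx, fun y hy => hp y (p.support_takeUntil_subset_support hx hy)⟩

theorem mem_compIn_compIn (h : w ∈ G.compIn S z) : w ∈ G.compIn (G.compIn S z) z := by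
  obtain ⟨p, hp⟩ := h
  exact ⟨p, support_subset_compIn p hp⟩

/-- Deleting a set of vertices from a component of `G[S]` or from all of `G[S]` leaves the same
components inside the given one. -/
theorem compIn_compIn_diff (a : V) : G.compIn (G.compIn S z \ {a}) z = G.compIn (S \ {a}) z := by
  apply Set.Subset.antisymm
  · exact compIn_mono (Set.sdiff_subset_sdiff_left compIn_subset)
  · rintro x ⟨p, hp⟩
    exact ⟨p, fun y hy => ⟨support_subset_compIn p (fun y hy => (hp y hy).1) y hy, (hp y hy).2⟩⟩

/-- A walk in `S` that enters `A` does so from the component of `G[S] - A` in which it starts. -/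
theorem exists_adj_of_walk {A : Set V} (p : G.Walk a b) (hp : ∀ x ∈ p.support, x ∈ S)
    (ha : a ∉ A) (hb : b ∈ A) : ∃ x ∈ G.compIn (S \ A) a, ∃ y ∈ A, G.Adj x y := by
  induction p with
  | nil => exact absurd hb ha
  | @cons a c b hadj q ih =>
    have haS : a ∈ S \ A := ⟨hp a (by simp), ha⟩
    by_cases hc : c ∈ A
    · exact ⟨a, self_mem_compIn haS, c, hc, hadj⟩
    · obtain ⟨x, hx, y, hy, hxy⟩ := ih (fun x hx => hp x (by simp [hx])) hc hb
      refine ⟨x, ?_, y, hy, hxy⟩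
      rwa [compIn_eq (compIn_adj (self_mem_compIn haS) hadj (mem_of_mem_compIn hx))] at hx

/-- In a connected set, every component left by the deletion of `a` contains a neighbour
of `a`. -/
theorem exists_adj_mem_compIn_diff (h : a ∈ G.compIn S w) (hw : w ≠ a) :
    ∃ y ∈ G.compIn (S \ {a}) w, G.Adj a y := by
  obtain ⟨p, hp⟩ := h
  obtain ⟨x, hx, y, rfl, hxy⟩ := exists_adj_of_walk p hp (A := {a}) hw rfl
  exact ⟨x, hx, hxy.symm⟩

theorem ComponentCompl.eq_compIn {X : Set V} {C : G.ComponentCompl X} (h : z ∈ C) :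
    (C : Set V) = G.compIn Xᶜ z := by
  apply Set.Subset.antisymm
  · rintro w ⟨hw, e⟩
    obtain ⟨hz, e'⟩ := h
    obtain ⟨p⟩ := ConnectedComponent.exact (e'.trans e.symm)
    let f : G.induce Xᶜ →g G := ⟨Subtype.val, fun h => h⟩
    refine ⟨p.map f, fun x hx => ?_⟩
    rw [Walk.support_map, List.mem_map] at hx
    obtain ⟨y, -, rfl⟩ := hx
    exact y.2
  · rintro w ⟨p, hp⟩
    induction p with
    | nil => exact h
    | cons hadj q ih =>
      refine ih (ComponentCompl.mem_of_adj _ _ h (hp _ (by simp)) hadj)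
        (fun x hx => hp x (by simp [hx]))

end CompIn

/-! ### The filter of an end -/

section EndFilter

variable {V : Type*} {G : SimpleGraph V}

theorem EndSpace.component_anti (ω : G.EndSpace) {X Y : Finset V} (h : X ⊆ Y) :
    (ω.component Y : Set V) ⊆ ω.component X := by
  induction ω using Quotient.inductionOn with
  | h R =>
    obtain ⟨M, hM⟩ := R.tailComponent_spec X
    obtain ⟨N, hN⟩ := R.tailComponent_spec Y
    have hX := hM (max M N) (le_max_left _ _)
    have hY := hN (max M N) (le_max_right _ _)
    change ((R.tailComponent Y : Set V)) ⊆ (R.tailComponent X : Set V)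
    rw [ComponentCompl.eq_compIn hX, ComponentCompl.eq_compIn hY]
    exact compIn_mono (Set.compl_subset_compl.2 (by exact_mod_cast h))

theorem EndSpace.ext_component {ω ω' : G.EndSpace}
    (h : ∀ X : Finset V, ω.component X = ω'.component X) : ω = ω' := by
  induction ω using Quotient.inductionOn
  induction ω' using Quotient.inductionOn
  exact Quotient.sound (Ray.equivalent_iff.2 h)

/-- The filter of an end `ω`: it is generated by the components `C(X, ω)`, so that a set of
vertices belongs to it if it contains some `C(X, ω)`. -/
def EndSpace.vertFilter (ω : G.EndSpace) : Filter V where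
  sets := {D | ∃ X : Finset V, (ω.component X : Set V) ⊆ D}
  univ_sets := ⟨∅, Set.subset_univ _⟩
  sets_of_superset := fun ⟨X, hX⟩ h => ⟨X, hX.trans h⟩
  inter_sets := by
    classical
    rintro A B ⟨X, hX⟩ ⟨Y, hY⟩
    exact ⟨X ∪ Y, Set.subset_inter
      ((ω.component_anti Finset.subset_union_left).trans hX)
      ((ω.component_anti Finset.subset_union_right).trans hY)⟩

theorem EndSpace.mem_vertFilter {ω : G.EndSpace} {D : Set V} :
    D ∈ ω.vertFilter ↔ ∃ X : Finset V, (ω.component X : Set V) ⊆ D := Iff.rfl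

theorem EndSpace.component_mem_vertFilter (ω : G.EndSpace) (X : Finset V) :
    (ω.component X : Set V) ∈ ω.vertFilter := ⟨X, le_rfl⟩

instance EndSpace.vertFilter_neBot (ω : G.EndSpace) : ω.vertFilter.NeBot := by
  rw [← Filter.empty_mem_iff_bot.not.trans Filter.neBot_iff.symm]
  rintro ⟨X, hX⟩
  obtain ⟨x, hx⟩ := (ω.component X).nonempty
  exact hX hx

theorem EndSpace.component_subset_compl (ω : G.EndSpace) (X : Finset V) :
    (ω.component X : Set V) ⊆ (X : Set V)ᶜ :=
  fun _ hx => ComponentCompl.notMem_of_mem hx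

theorem EndSpace.compl_mem_vertFilter (ω : G.EndSpace) (X : Finset V) :
    (X : Set V)ᶜ ∈ ω.vertFilter := ⟨X, ω.component_subset_compl X⟩

theorem Ray.eventually_mem {R : G.Ray} {D : Set V}
    (h : D ∈ EndSpace.vertFilter (Quotient.mk (raySetoid G) R)) :
    ∃ N, ∀ n, N ≤ n → R.vert n ∈ D := by
  obtain ⟨X, hX⟩ := h
  obtain ⟨N, hN⟩ := R.tailComponent_spec X
  exact ⟨N, fun n hn => hX (hN n hn)⟩

/-- An end lives in a component of `G - X`, or in the complement of this component. -/
theorem EndSpace.compIn_mem_or_compl_mem (ω : G.EndSpace) (X : Finset V) (z : V) :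
    G.compIn (X : Set V)ᶜ z ∈ ω.vertFilter ∨ (G.compIn (X : Set V)ᶜ z)ᶜ ∈ ω.vertFilter := by
  by_cases h : ((ω.component X : Set V) ∩ G.compIn (X : Set V)ᶜ z).Nonempty
  · obtain ⟨x, hx, hx'⟩ := h
    left
    rw [← compIn_eq hx', ← ComponentCompl.eq_compIn hx]
    exact ω.component_mem_vertFilter X
  · right
    exact ⟨X, fun x hx hx' => h ⟨x, hx, hx'⟩⟩

theorem Ray.compIn_mem_vertFilter {R : G.Ray} {X : Finset V} {z : V} {N : ℕ}
    (h : ∀ n, N ≤ n → R.vert n ∈ G.compIn (X : Set V)ᶜ z) :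
    G.compIn (X : Set V)ᶜ z ∈ EndSpace.vertFilter (Quotient.mk (raySetoid G) R) := by
  obtain h' | h' := EndSpace.compIn_mem_or_compl_mem (Quotient.mk (raySetoid G) R) X z
  · exact h'
  · obtain ⟨M, hM⟩ := Ray.eventually_mem h'
    exact absurd (h (max M N) (le_max_right _ _)) (hM (max M N) (le_max_left _ _))

theorem EndSpace.mem_endBoundary {ω : G.EndSpace} {H : G.Subgraph} :
    ω ∈ H.endBoundary ↔ ∃ᶠ v in ω.vertFilter, v ∈ H.verts := by
  constructor
  · rintro h ⟨X, hX⟩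
    obtain ⟨x, hx, hx'⟩ := h X
    exact hX hx hx'
  · intro h X
    obtain ⟨x, hx, hx'⟩ := (h.and_eventually (ω.component_mem_vertFilter X)).exists
    exact ⟨x, hx', hx⟩

end EndFilter

/-! ### Dispersed sets and normal covers -/

/-- A set of vertices is dispersed if every end can be separated from it by finitely many
vertices. -/
def IsDispersed {V : Type*} (G : SimpleGraph V) (U : Set V) : Prop :=
  ∀ ω : G.EndSpace, Uᶜ ∈ ω.vertFilter

/-- A set `D` of vertices is normally covered if every end living in `D` is in the closure of one
fixed countable union of dispersed sets. (By Jung's theorem such unions are the vertex sets that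
are contained in normal trees.) -/
def IsCovered {V : Type*} (G : SimpleGraph V) (D : Set V) : Prop :=
  ∃ U : ℕ → Set V, (∀ n, G.IsDispersed (U n)) ∧
    ∀ ω : G.EndSpace, D ∈ ω.vertFilter → ∃ᶠ v in ω.vertFilter, v ∈ ⋃ n, U n

theorem IsCovered.mono {V : Type*} {G : SimpleGraph V} {D D' : Set V} (h : G.IsCovered D)
    (hD : D' ⊆ D) : G.IsCovered D' := by
  obtain ⟨U, hU, hU'⟩ := h
  exact ⟨U, hU, fun ω hω => hU' ω (Filter.mem_of_superset hω hD)⟩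

/-! ### Depth-first rays -/

/-- A depth-first ray: a sequence `v` of vertices together with a decreasing sequence `D` of
connected sets such that `v k ∈ D k`, the set `D (k + 1)` is a component of `G[D k] - v k`, and
`v (k + 1)` is a neighbour of `v k` in it. -/
structure IsDepthFirst {V : Type*} (G : SimpleGraph V) (v : ℕ → V) (D : ℕ → Set V) :
    Prop where
  zero : D 0 = Set.univ
  mem : ∀ k, v k ∈ D k
  succ : ∀ k, D (k + 1) = G.compIn (D k \ {v k}) (v (k + 1))
  adj : ∀ k, G.Adj (v k) (v (k + 1))

namespace IsDepthFirst

variable {V : Type*} {G : SimpleGraph V} {v : ℕ → V} {D : ℕ → Set V}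

theorem succ_subset (h : G.IsDepthFirst v D) (k : ℕ) : D (k + 1) ⊆ D k \ {v k} := by
  rw [h.succ k]
  exact compIn_subset

theorem antitone (h : G.IsDepthFirst v D) : Antitone D :=
  antitone_nat_of_succ_le fun k => (h.succ_subset k).trans Set.sdiff_subset

theorem vert_mem (h : G.IsDepthFirst v D) {k m : ℕ} (hkm : k ≤ m) : v m ∈ D k :=
  h.antitone hkm (h.mem m)

theorem vert_notMem (h : G.IsDepthFirst v D) {k m : ℕ} (hkm : k < m) : v k ∉ D m := fun hk =>
  (h.succ_subset k (h.antitone hkm hk)).2 rfl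

/-- The ray `v 0, v 1, …`. -/
def ray (h : G.IsDepthFirst v D) : G.Ray where
  vert := v
  injective := by
    intro i j hij
    rcases lt_trichotomy i j with hlt | heq | hlt
    · exact absurd (hij ▸ h.mem j) (h.vert_notMem hlt)
    · exact heq
    · exact absurd (hij ▸ h.mem i) (h.vert_notMem hlt)
  adj := h.adj

/-- The end of the ray `v 0, v 1, …`. -/
def toEnd (h : G.IsDepthFirst v D) : G.EndSpace := Quotient.mk (raySetoid G) h.ray

theorem eventually_mem (h : G.IsDepthFirst v D) {A : Set V} (hA : A ∈ h.toEnd.vertFilter) :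
    ∃ N, ∀ n, N ≤ n → v n ∈ A := Ray.eventually_mem hA

theorem eq_compIn_of_mem (h : G.IsDepthFirst v D) (k : ℕ) {z : V} (hz : z ∈ D (k + 1)) :
    D (k + 1) = G.compIn (D k \ {v k}) z := by
  rw [h.succ k] at hz ⊢
  exact (compIn_eq hz).symm

/-- Every `D k` is a component of `G` minus the first `k` vertices. -/
theorem eq_compIn_compl (h : G.IsDepthFirst v D) (hG : G.Connected) [DecidableEq V] (k : ℕ) :
    ∀ z ∈ D k, D k = G.compIn (((Finset.range k).image v : Finset V) : Set V)ᶜ z := by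
  induction k with
  | zero =>
    intro z _
    rw [h.zero]
    refine (Set.eq_univ_of_forall fun w => ?_).symm
    obtain ⟨p⟩ := hG.preconnected z w
    exact ⟨p, by simp⟩
  | succ k ih =>
    intro z hz
    rw [h.eq_compIn_of_mem k hz, ih z (h.succ_subset k hz).1, compIn_compIn_diff]
    congr 1
    ext x
    simp [Finset.range_add_one, not_or, and_comm]

theorem mem_vertFilter (h : G.IsDepthFirst v D) (hG : G.Connected) (k : ℕ) :
    D k ∈ h.toEnd.vertFilter := by
  classical
  rw [h.eq_compIn_compl hG k _ (h.mem k)]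
  refine Ray.compIn_mem_vertFilter (N := k) fun n hn => ?_
  rw [← h.eq_compIn_compl hG k _ (h.mem k)]
  exact h.vert_mem hn

theorem connected (h : G.IsDepthFirst v D) (hG : G.Connected) (k : ℕ) {a b : V} (ha : a ∈ D k)
    (hb : b ∈ D k) : b ∈ G.compIn (D k) a := by
  classical
  have e := h.eq_compIn_compl hG k a ha
  rw [e] at hb ⊢
  exact mem_compIn_compIn hb

/-- The only vertex outside `D (k + 1)` but inside `D k` that may have neighbours in `D (k + 1)`
is `v k`. -/
theorem eq_vert_of_adj (h : G.IsDepthFirst v D) {k : ℕ} {a b : V} (ha : a ∈ D k)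
    (ha' : a ∉ D (k + 1)) (hb : b ∈ D (k + 1)) (hab : G.Adj a b) : a = v k := by
  by_contra hne
  rw [h.succ k] at ha' hb
  exact ha' (compIn_adj hb hab.symm ⟨ha, hne⟩)

theorem exists_mem_notMem_succ (h : G.IsDepthFirst v D) {a : V} {K : ℕ} (haK : a ∈ D K)
    {M : ℕ} (ha : a ∉ D M) : ∃ j, K ≤ j ∧ a ∈ D j ∧ a ∉ D (j + 1) := by
  by_contra hcon
  push Not at hcon
  have key : ∀ n, K ≤ n → a ∈ D n := fun n hn => by
    induction n, hn using Nat.le_induction with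
    | base => exact haK
    | succ n hn ih => exact hcon n hn ih
  exact ha (h.antitone (le_max_left M K) (key _ (le_max_right _ _)))

/-- A finite set meets almost all `D k` only in the intersection of all of them. -/
theorem exists_forall_mem (h : G.IsDepthFirst v D) (X : Finset V) :
    ∃ K, ∀ x ∈ X, x ∈ D K → ∀ k, x ∈ D k := by
  classical
  induction X using Finset.induction_on with
  | empty => exact ⟨0, by simp⟩
  | insert a X _ ih =>
    obtain ⟨K, hK⟩ := ih
    by_cases ha : ∀ k, a ∈ D k
    · refine ⟨K, fun x hx hxK => ?_⟩
      rcases Finset.mem_insert.1 hx with rfl | hx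
      exacts [ha, hK x hx hxK]
    · push Not at ha
      obtain ⟨M, hM⟩ := ha
      refine ⟨max K M, fun x hx hxK => ?_⟩
      rcases Finset.mem_insert.1 hx with rfl | hx
      · exact absurd (h.antitone (le_max_right _ _) hxK) hM
      · exact hK x hx (h.antitone (le_max_left _ _) hxK)

end IsDepthFirst

/-- Among the neighbours of `a` in `D`, the vertex `v` minimizes the distance in `G[D]` to the
set `Θ`. -/
structure IsNearest {V : Type*} (G : SimpleGraph V) (a : V) (D Θ : Set V) (v : V) : Prop where
  mem : v ∈ D
  adj : G.Adj a v
  exists_le : ∀ w ∈ D, G.Adj a w → ∀ θ ∈ Θ, ∀ p : G.Walk w θ, (∀ x ∈ p.support, x ∈ D) →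
    ∃ θ' ∈ Θ, ∃ q : G.Walk v θ', (∀ x ∈ q.support, x ∈ D) ∧ q.length ≤ p.length

theorem exists_isNearest {V : Type*} {G : SimpleGraph V} {a : V} {D : Set V} (Θ : Set V)
    (h : ∃ w ∈ D, G.Adj a w) : ∃ v, G.IsNearest a D Θ v := by
  classical
  by_cases hn : ∃ n, ∃ w ∈ D, G.Adj a w ∧ ∃ θ ∈ Θ, ∃ p : G.Walk w θ,
      (∀ x ∈ p.support, x ∈ D) ∧ p.length = n
  · obtain ⟨v, hv, hav, θ, hθ, q, hq, hlen⟩ := Nat.find_spec hn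
    refine ⟨v, hv, hav, fun w hw haw θ' hθ' p hp => ⟨θ, hθ, q, hq, ?_⟩⟩
    rw [hlen]
    exact Nat.find_min' hn ⟨w, hw, haw, θ', hθ', p, hp, rfl⟩
  · obtain ⟨v, hv, hav⟩ := h
    refine ⟨v, hv, hav, fun w hw haw θ' hθ' p hp => absurd ⟨_, w, hw, haw, θ', hθ', p, hp, rfl⟩ hn⟩

/-- The depth-first ray `v` is guided by the sets `U 0, U 1, …`: each step heads for the set
`U m` of least index that meets the current component. A step to `v (k + 1)` need only take
`U 0, …, U k` into account. -/
def IsGuided {V : Type*} (G : SimpleGraph V) (v : ℕ → V) (D U : ℕ → Set V) : Prop :=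
  ∀ k m, m ≤ k → (U m ∩ D (k + 1)).Nonempty → (∀ j < m, ¬ (U j ∩ D (k + 1)).Nonempty) →
    G.IsNearest (v k) (D (k + 1)) (U m) (v (k + 1))

/-- A depth-first ray guided by sets that can be separated from its end leaves all these sets
behind. If `U n` is the first set for which this fails, then all but finitely many steps head for
`U n`. The shortest ways to `U n` pass a finite separator `X` at a vertex common to all `D k`,
so that each step shortens them. -/
theorem IsDepthFirst.exists_disjoint {V : Type*} {G : SimpleGraph V} {v : ℕ → V} {D U : ℕ → Set V}
    (h : G.IsDepthFirst v D) (hG : G.Connected) (hU : G.IsGuided v D U)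
    (hsep : ∀ n, (U n)ᶜ ∈ h.toEnd.vertFilter) (n : ℕ) : ∃ k, ¬ (U n ∩ D k).Nonempty := by
  classical
  induction n using Nat.strong_induction_on with
  | _ n ih =>
  by_contra! hne
  obtain ⟨K₁, hK₁⟩ : ∃ K, ∀ j < n, ∀ k, K ≤ k → ¬ (U j ∩ D k).Nonempty := by
    choose! f hf using ih
    refine ⟨(Finset.range n).sup f, fun j hj k hk hx => hf j hj ?_⟩
    exact hx.mono (Set.inter_subset_inter_right _
      (h.antitone ((Finset.le_sup (f := f) (Finset.mem_range.2 hj)).trans hk)))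
  obtain ⟨X, hX⟩ := hsep n
  obtain ⟨K₂, hK₂⟩ := h.eventually_mem (h.toEnd.component_mem_vertFilter X)
  obtain ⟨K₃, hK₃⟩ := h.exists_forall_mem X
  obtain ⟨K, hK1, hK2, hK3, hKn⟩ : ∃ K, K₁ ≤ K ∧ K₂ ≤ K ∧ K₃ ≤ K ∧ n ≤ K :=
    ⟨max (max K₁ K₂) (max K₃ n), by simp, by simp, by simp, by simp⟩
  have hnear : ∀ k, K ≤ k → G.IsNearest (v k) (D (k + 1)) (U n) (v (k + 1)) := fun k hk =>
    hU k n (hKn.trans hk) (hne _) fun j hj => hK₁ j hj _ (by omega)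
  have hdesc : ∀ k, K ≤ k → ∀ θ ∈ U n, ∀ p : G.Walk (v (k + 1)) θ,
      (∀ x ∈ p.support, x ∈ D (k + 1)) → ∃ θ' ∈ U n, ∃ q : G.Walk (v (k + 2)) θ',
        (∀ x ∈ q.support, x ∈ D (k + 2)) ∧ q.length < p.length := by
    intro k hk θ hθ p₀ hp₀
    have hvC : v (k + 1) ∈ (h.toEnd.component X : Set V) := hK₂ _ (by omega)
    have hp : ∀ x ∈ p₀.bypass.support, x ∈ D (k + 1) := fun x hx =>
      hp₀ x (p₀.support_bypass_subset_support hx)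
    have hpath := p₀.bypass_isPath
    have hlen := p₀.length_bypass_le_length
    generalize p₀.bypass = p at hp hpath hlen
    obtain ⟨x, hxp, hxX⟩ : ∃ x ∈ p.support, x ∈ X := by
      by_contra! hcon
      refine hX ?_ hθ
      rw [ComponentCompl.eq_compIn hvC]
      exact ⟨p, fun x hx => hcon x hx⟩
    have hxD : x ∈ D (k + 2) := hK₃ x hxX (h.antitone (by omega) (hp x hxp)) _
    cases p with
    | nil =>
      rw [Walk.support_nil, List.mem_singleton] at hxp
      exact absurd (hxp ▸ hxD) (h.vert_notMem (Nat.lt_succ_self _))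
    | @cons _ w _ hadj q =>
      rw [Walk.cons_isPath_iff] at hpath
      have hxq : x ∈ q.support := by
        rcases List.mem_cons.1 (Walk.support_cons hadj q ▸ hxp) with rfl | hx
        · exact absurd hxD (h.vert_notMem (Nat.lt_succ_self _))
        · exact hx
      have hq : ∀ y ∈ q.support, y ∈ D (k + 1) \ {v (k + 1)} := fun y hy =>
        ⟨hp y (by simp [hy]), fun hyv => hpath.2 (Set.mem_singleton_iff.1 hyv ▸ hy)⟩
      have hwx : G.compIn (D (k + 1) \ {v (k + 1)}) w = D (k + 2) := by
        rw [h.eq_compIn_of_mem (k + 1) hxD]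
        exact (compIn_eq (support_subset_compIn q hq x hxq)).symm
      have hqD : ∀ y ∈ q.support, y ∈ D (k + 2) := fun y hy =>
        hwx ▸ support_subset_compIn q hq y hy
      obtain ⟨θ', hθ', q', hq', hle⟩ := (hnear (k + 1) (by omega)).exists_le w
        (hqD w q.start_mem_support) hadj θ hθ q hqD
      refine ⟨θ', hθ', q', hq', ?_⟩
      rw [Walk.length_cons] at hlen
      omega
  have hnone : ∀ m k, K ≤ k → ∀ θ ∈ U n, ∀ p : G.Walk (v (k + 1)) θ,
      (∀ x ∈ p.support, x ∈ D (k + 1)) → m ≤ p.length := by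
    intro m
    induction m with
    | zero => intros; exact Nat.zero_le _
    | succ m ihm =>
      intro k hk θ hθ p hp
      obtain ⟨θ', hθ', q, hq, hlt⟩ := hdesc k hk θ hθ p hp
      have := ihm (k + 1) (by omega) θ' hθ' q hq
      omega
  obtain ⟨θ, hθ, hθD⟩ := hne (K + 1)
  obtain ⟨p, hp⟩ := h.connected hG (K + 1) (h.mem _) hθD
  have := hnone (p.length + 1) K le_rfl θ hθ p hp
  omega

/-! ### From local to global covers -/

/-- If all components that remain when one vertex is deleted from a component of `G - X` are
normally covered, then so is this component. -/
theorem isCovered_of_forall_compIn {V : Type*} {G : SimpleGraph V} (X : Finset V) (z a : V)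
    (h : ∀ w ∈ G.compIn (X : Set V)ᶜ z \ {a},
      G.IsCovered (G.compIn (G.compIn (X : Set V)ᶜ z \ {a}) w)) :
    G.IsCovered (G.compIn (X : Set V)ᶜ z) := by
  classical
  set D := G.compIn (X : Set V)ᶜ z with hD
  -- one cover is chosen for each component, independently of a vertex that names the component
  have hch : ∀ F : Set V, ∃ U : ℕ → Set V, G.IsCovered F → (∀ n, G.IsDispersed (U n)) ∧
      ∀ ω : G.EndSpace, F ∈ ω.vertFilter → ∃ᶠ v in ω.vertFilter, v ∈ ⋃ n, U n := by
    intro F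
    by_cases hF : G.IsCovered F
    · obtain ⟨U, hU⟩ := hF
      exact ⟨U, fun _ => hU⟩
    · exact ⟨fun _ => ∅, fun h => absurd h hF⟩
  choose U hU using hch
  have key : ∀ ω : G.EndSpace, D ∈ ω.vertFilter →
      ∃ w ∈ D \ {a}, G.compIn (D \ {a}) w ∈ ω.vertFilter := by
    intro ω hω
    obtain ⟨w, hwC, hwD⟩ := (Filter.nonempty_of_mem
      (Filter.inter_mem (ω.component_mem_vertFilter (insert a X)) hω))
    refine ⟨w, ⟨hwD, fun hwa => ?_⟩, ?_⟩
    · exact ω.component_subset_compl _ hwC (by simp [Set.mem_singleton_iff.1 hwa])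
    · have hz : D = G.compIn (X : Set V)ᶜ w := (compIn_eq hwD).symm
      rw [hz, compIn_compIn_diff]
      refine Filter.mem_of_superset (ω.component_mem_vertFilter (insert a X)) ?_
      rw [ComponentCompl.eq_compIn hwC]
      refine compIn_mono fun x hx => ?_
      simpa [not_or, and_comm] using hx
  refine ⟨fun n => {w | w ∈ D \ {a} ∧ w ∈ U (G.compIn (D \ {a}) w) n}, fun n ω => ?_,
    fun ω hω => ?_⟩
  · rcases ω.compIn_mem_or_compl_mem X z with hω | hω
    · obtain ⟨w, hw, hwω⟩ := key ω hω
      filter_upwards [hwω, (hU _ (h w hw)).1 n ω] with x hx hx' hxU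
      apply hx'
      rw [← compIn_eq hx]
      exact hxU.2
    · filter_upwards [hω] with x hx hxU
      exact hx hxU.1.1
  · obtain ⟨w, hw, hwω⟩ := key ω hω
    refine (((hU _ (h w hw)).2 ω hwω).and_eventually hwω).mono ?_
    rintro x ⟨hx, hxw⟩
    obtain ⟨n, hn⟩ := Set.mem_iUnion.1 hx
    refine Set.mem_iUnion.2 ⟨n, compIn_subset hxw, ?_⟩
    rw [compIn_eq hxw]
    exact hn

/-- Dependent choice with a memory: a sequence can be built if every initial segment has an
admissible next term. -/
theorem exists_seq_of_forall_prefix {α : Type*} (a₀ : α) (P : α → Prop) (h₀ : P a₀)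
    (Q : ℕ → (ℕ → α) → α → Prop)
    (hQ : ∀ k s s' a, (∀ i ≤ k, s i = s' i) → Q k s a → Q k s' a)
    (hex : ∀ k s, P (s k) → ∃ a, P a ∧ Q k s a) :
    ∃ s : ℕ → α, s 0 = a₀ ∧ (∀ k, P (s k)) ∧ ∀ k, Q k s (s (k + 1)) := by
  classical
  have : Nonempty α := ⟨a₀⟩
  choose! f hf hf' using hex
  let S : ℕ → ℕ → α := fun n =>
    Nat.rec (fun _ => a₀) (fun k s => Function.update s (k + 1) (f k s)) n
  have hS : ∀ k, S (k + 1) = Function.update (S k) (k + 1) (f k (S k)) := fun _ => rfl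
  have hstab : ∀ m k, k ≤ m → S m k = S k k := by
    intro m k hkm
    induction m, hkm using Nat.le_induction with
    | base => rfl
    | succ m hm ih => rw [hS, Function.update_of_ne (by omega), ih]
  have hsucc : ∀ k, S (k + 1) (k + 1) = f k (S k) := fun k => by
    rw [hS, Function.update_self]
  have hP : ∀ k, P (S k k) := fun k => by
    induction k with
    | zero => exact h₀
    | succ k ih => rw [hsucc]; exact hf k _ ih
  refine ⟨fun k => S k k, rfl, hP, fun k => ?_⟩
  change Q k _ (S (k + 1) (k + 1))
  rw [hsucc]
  exact hQ k (S k) _ _ (fun i hi => hstab k i hi) (hf' k _ (hP k))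

/-- If every end lives in a normally covered component of `G - X` for some finite `X`, then `G` is
normally covered. Otherwise there is a depth-first ray along sets `D k` that are not normally
covered. Whenever a vertex `p` of the ray has a normally covered component of some `G - X p`
around it, the ray is guided to use up `X p`, and from then on `p` has no neighbour in `D k`. But
for the end of the ray there is a separator `X` that contains a vertex of all `D k`, and a path
from the ray to this vertex enters the intersection of the `D k` at a neighbour of such a `p`. -/
theorem isCovered_univ {V : Type*} {G : SimpleGraph V} (hG : G.Connected)
    (hloc : ∀ ω : G.EndSpace, ∃ X : Finset V, G.IsCovered (ω.component X : Set V)) :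
    G.IsCovered Set.univ := by
  classical
  by_contra hbad
  have hch : ∀ p : V, ∃ X : Finset V, (∃ Y : Finset V, p ∉ Y ∧
      G.IsCovered (G.compIn (Y : Set V)ᶜ p)) → p ∉ X ∧ G.IsCovered (G.compIn (X : Set V)ᶜ p) := by
    intro p
    by_cases hp : ∃ Y : Finset V, p ∉ Y ∧ G.IsCovered (G.compIn (Y : Set V)ᶜ p)
    · obtain ⟨Y, hY⟩ := hp
      exact ⟨Y, fun _ => hY⟩
    · exact ⟨∅, fun h => absurd h hp⟩
  choose X hX using hch
  obtain ⟨r⟩ := hG.nonempty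
  let P : V × Set V → Prop := fun s => s.1 ∈ s.2 ∧ ¬ G.IsCovered s.2 ∧
    ∃ (Y : Finset V), s.2 = G.compIn (Y : Set V)ᶜ s.1
  let Q : ℕ → (ℕ → V × Set V) → V × Set V → Prop := fun k s b =>
    b.2 = G.compIn ((s k).2 \ {(s k).1}) b.1 ∧ G.Adj (s k).1 b.1 ∧
    ∀ m ≤ k, ((X (s m).1 : Set V) ∩ b.2).Nonempty →
      (∀ j < m, ¬ ((X (s j).1 : Set V) ∩ b.2).Nonempty) →
      G.IsNearest (s k).1 b.2 (X (s m).1) b.1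
  obtain ⟨s, hs0, hsP, hsQ⟩ := exists_seq_of_forall_prefix (r, Set.univ) P ⟨trivial, hbad, ∅, by
      refine (Set.eq_univ_of_forall fun w => ?_).symm
      obtain ⟨p⟩ := hG.preconnected r w
      exact ⟨p, by simp⟩⟩ Q (by
    rintro k s s' b hss ⟨h1, h2, h3⟩
    refine ⟨hss k le_rfl ▸ h1, hss k le_rfl ▸ h2, fun m hm hne hj => ?_⟩
    rw [← hss k le_rfl, ← hss m hm]
    rw [← hss m hm] at hne
    exact h3 m hm hne fun j hjm => hss j (by omega) ▸ hj j hjm) (by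
    rintro k s ⟨hmem, hbadk, Y, hY⟩
    obtain ⟨w, hw, hwbad⟩ : ∃ w ∈ (s k).2 \ {(s k).1},
        ¬ G.IsCovered (G.compIn ((s k).2 \ {(s k).1}) w) := by
      by_contra! hcon
      rw [hY] at hcon
      exact hbadk (hY ▸ isCovered_of_forall_compIn Y _ _ hcon)
    have hnbr : ∃ y ∈ G.compIn ((s k).2 \ {(s k).1}) w, G.Adj (s k).1 y := by
      refine exists_adj_mem_compIn_diff ?_ hw.2
      have hwk := hw.1
      rw [hY] at hwk ⊢
      rw [← compIn_eq hwk]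
      exact mem_compIn_compIn (compIn_symm hwk)
    have hfin : ∀ y ∈ G.compIn ((s k).2 \ {(s k).1}) w, ∃ Z : Finset V,
        G.compIn ((s k).2 \ {(s k).1}) w = G.compIn (Z : Set V)ᶜ y := by
      intro y hy
      refine ⟨insert (s k).1 Y, ?_⟩
      have hyY : (s k).2 = G.compIn (Y : Set V)ᶜ y := by
        have := (compIn_subset hy).1
        rw [hY] at this ⊢
        exact (compIn_eq this).symm
      rw [← compIn_eq hy, hyY, compIn_compIn_diff]
      congr 1
      ext x
      simp [not_or, and_comm]
    by_cases hm : ∃ m, m ≤ k ∧ ((X (s m).1 : Set V) ∩ G.compIn ((s k).2 \ {(s k).1}) w).Nonempty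
    · obtain ⟨y, hy⟩ := exists_isNearest (X (s (Nat.find hm)).1 : Set V) hnbr
      refine ⟨(y, G.compIn ((s k).2 \ {(s k).1}) w), ⟨hy.mem, hwbad, hfin y hy.mem⟩,
        (compIn_eq hy.mem).symm, hy.adj, fun m hmk hne hj => ?_⟩
      have : Nat.find hm = m := by
        refine le_antisymm (Nat.find_min' hm ⟨hmk, hne⟩) (not_lt.1 fun hlt => ?_)
        exact hj _ hlt (Nat.find_spec hm).2
      rw [← this]
      exact hy
    · obtain ⟨y, hy, hay⟩ := hnbr
      exact ⟨(y, G.compIn ((s k).2 \ {(s k).1}) w), ⟨hy, hwbad, hfin y hy⟩,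
        (compIn_eq hy).symm, hay, fun m hmk hne => absurd ⟨m, hmk, hne⟩ hm⟩)
  set v : ℕ → V := fun k => (s k).1 with hv
  set D : ℕ → Set V := fun k => (s k).2 with hD
  have h : G.IsDepthFirst v D :=
    ⟨by simp [hD, hs0], fun k => (hsP k).1, fun k => (hsQ k).1, fun k => (hsQ k).2.1⟩
  have hguided : G.IsGuided v D (fun m => (X (v m) : Set V)) := fun k => (hsQ k).2.2
  have hexh := h.exists_disjoint hG hguided fun n => h.toEnd.compl_mem_vertFilter (X (v n))
  obtain ⟨Y, hY⟩ := hloc h.toEnd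
  obtain ⟨K₁, hK₁⟩ := h.exists_forall_mem Y
  obtain ⟨K₂, hK₂⟩ := h.eventually_mem (h.toEnd.component_mem_vertFilter Y)
  obtain ⟨K, hK1, hK2⟩ : ∃ K, K₁ ≤ K ∧ K₂ ≤ K := ⟨max K₁ K₂, by simp, by simp⟩
  have hvK := hK₂ K hK2
  have hCK : (h.toEnd.component Y : Set V) = G.compIn (Y : Set V)ᶜ (v K) :=
    ComponentCompl.eq_compIn hvK
  rw [hCK] at hY
  -- `D K` is not contained in the normally covered component, so it meets the separator `Y`
  obtain ⟨z, hzY, hzK⟩ : ∃ z ∈ Y, z ∈ D K := by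
    by_contra! hcon
    refine (hsP K).2.1 (hY.mono fun x hx => ?_)
    exact compIn_mono (fun y hy hyY => hcon y hyY hy) (h.connected hG K (h.mem K) hx)
  obtain ⟨p, hp⟩ := h.connected hG K (h.mem K) hzK
  obtain ⟨q, hq, q', hq', hadj⟩ := exists_adj_of_walk p hp (A := ⋂ k, D k)
    (fun hcon => h.vert_notMem (Nat.lt_succ_self K) (Set.mem_iInter.1 hcon (K + 1)))
    (Set.mem_iInter.2 (hK₁ z hzY (h.antitone hK1 hzK)))
  rw [Set.mem_iInter] at hq'
  have hqY : q ∈ G.compIn (Y : Set V)ᶜ (v K) := compIn_mono (fun y hy hyY =>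
    hy.2 (Set.mem_iInter.2 (hK₁ y hyY (h.antitone hK1 hy.1)))) hq
  have hqD := compIn_subset hq
  obtain ⟨M, hM⟩ : ∃ M, q ∉ D M := by
    by_contra! hcon
    exact hqD.2 (Set.mem_iInter.2 hcon)
  obtain ⟨j, -, hqj, hqj'⟩ := h.exists_mem_notMem_succ hqD.1 hM
  obtain rfl := h.eq_vert_of_adj hqj hqj' (hq' _) hadj
  obtain ⟨hj, hjc⟩ := hX (v j) ⟨Y, compIn_subset hqY, by rwa [compIn_eq hqY]⟩
  obtain ⟨k, hk⟩ := hexh j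
  have hDX : D k ⊆ (X (v j) : Set V)ᶜ := fun x hx hxX => hk ⟨x, hxX, hx⟩
  refine (hsP k).2.1 (hjc.mono fun x hx => ?_)
  exact compIn_trans (compIn_adj (self_mem_compIn hj) hadj (hDX (hq' k)))
    (compIn_mono hDX (h.connected hG k (hq' k) hx))

/-! ### The order of a normal tree -/

namespace Subgraph

variable {V : Type*} {G : SimpleGraph V} {T : G.Subgraph} {r a b c : T.verts}

theorem TreeLE.mem_support (h : T.TreeLE r a b) (hT : T.coe.IsTree) {p : T.coe.Walk r b}
    (hp : p.IsPath) : a ∈ p.support := by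
  obtain ⟨q, hq, ha⟩ := h
  have : q = p := congrArg Subtype.val
    ((hT.isAcyclic.subsingleton_path r b).elim ⟨q, hq⟩ ⟨p, hp⟩)
  exact this ▸ ha

theorem exists_isPath_coe (hT : T.coe.IsTree) (r a : T.verts) :
    ∃ p : T.coe.Walk r a, p.IsPath := by
  classical
  obtain ⟨p⟩ := hT.connected.preconnected r a
  exact ⟨p.bypass, p.bypass_isPath⟩

theorem treeLE_refl (hT : T.coe.IsTree) (r a : T.verts) : T.TreeLE r a a := by
  obtain ⟨p, hp⟩ := exists_isPath_coe hT r a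
  exact ⟨p, hp, p.end_mem_support⟩

theorem TreeLE.trans (hT : T.coe.IsTree) (h : T.TreeLE r a b) (h' : T.TreeLE r b c) :
    T.TreeLE r a c := by
  classical
  obtain ⟨p, hp, hb⟩ := h'
  exact ⟨p, hp, p.support_takeUntil_subset_support hb (h.mem_support hT (hp.takeUntil hb))⟩

theorem TreeLE.total_of_le (hT : T.coe.IsTree) (h : T.TreeLE r a c) (h' : T.TreeLE r b c) :
    T.TreeLE r a b ∨ T.TreeLE r b a := by
  classical
  obtain ⟨p, hp, hb⟩ := h'
  have ha := h.mem_support hT hp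
  rw [← p.take_spec hb, Walk.mem_support_append_iff] at ha
  rcases ha with ha | ha
  · exact Or.inl ⟨_, hp.takeUntil hb, ha⟩
  · right
    refine ⟨(p.takeUntil b hb).append ((p.dropUntil b hb).takeUntil a ha), ?_, ?_⟩
    · rw [← p.take_spec hb, ← (p.dropUntil b hb).take_spec ha, Walk.append_assoc] at hp
      exact hp.of_append_left
    · rw [Walk.mem_support_append_iff]
      exact Or.inl (Walk.end_mem_support _)

theorem treeLE_or_treeLE_of_adj (hT : T.coe.IsTree) (r : T.verts) (h : T.coe.Adj a b) :
    T.TreeLE r a b ∨ T.TreeLE r b a := by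
  obtain ⟨p, hp⟩ := exists_isPath_coe hT r a
  by_cases hb : b ∈ p.support
  · exact Or.inr ⟨p, hp, hb⟩
  · exact Or.inl ⟨p.concat h, hp.concat hb h, by simp [Walk.support_concat]⟩

namespace IsNormalTree

/-- Two vertices of a normal tree are comparable if they are joined by a walk without inner
vertices in the tree. -/
theorem comparable_of_walk (hT : T.IsNormalTree r) (p : G.Walk (a : V) (b : V))
    (hp : ∀ x ∈ p.support, x ∈ T.verts → x = a ∨ x = b) : T.TreeLE r a b ∨ T.TreeLE r b a := by
  classical
  by_cases hab : a = b
  · exact Or.inl (hab ▸ treeLE_refl hT.isTree r a)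
  by_cases hadj : T.coe.Adj a b
  · exact treeLE_or_treeLE_of_adj hT.isTree r hadj
  have hp' : ∀ x ∈ p.bypass.support, x ∈ T.verts → x = a ∨ x = b := fun x hx =>
    hp x (p.support_bypass_subset_support hx)
  refine hT.comparable a b p.bypass ⟨p.bypass_isPath, ?_, fun w hw => ⟨hp' w hw, ?_⟩, ?_⟩
  · rw [Nat.pos_iff_ne_zero]
    exact fun h0 => hab (Subtype.ext (Walk.eq_of_length_eq_zero h0))
  · rintro (rfl | rfl)
    exacts [a.2, b.2]
  · intro e
    induction e using Sym2.ind with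
    | _ x y =>
    intro he hxy
    rw [Subgraph.mem_edgeSet] at hxy
    rcases hp' x (Walk.fst_mem_support_of_mem_edges _ he) hxy.fst_mem with rfl | rfl <;>
    rcases hp' y (Walk.snd_mem_support_of_mem_edges _ he) hxy.snd_mem with rfl | rfl
    · exact hxy.ne rfl
    · exact hadj hxy
    · exact hadj hxy.symm
    · exact hxy.ne rfl

/-- The separation property of normal trees: a walk between two vertices of the tree contains a
common lower bound of them. -/
theorem exists_le_le_mem_support (hT : T.IsNormalTree r) (p : G.Walk (a : V) (b : V)) :
    ∃ z : T.verts, (z : V) ∈ p.support ∧ T.TreeLE r z a ∧ T.TreeLE r z b := by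
  -- `a` is the last vertex of the tree on the part `q` of the walk already traversed
  suffices H : ∀ (u w : V) (p : G.Walk u w), w = b → ∀ (a : T.verts) (q : G.Walk (a : V) u),
      (∀ x ∈ q.support, x ∈ T.verts → x = a) →
      ∃ z : T.verts, ((z : V) ∈ p.support ∨ z = a) ∧ T.TreeLE r z a ∧ T.TreeLE r z b by
    obtain ⟨z, hz, hza, hzb⟩ := H a b p rfl a .nil (by simp)
    refine ⟨z, ?_, hza, hzb⟩
    rcases hz with hz | rfl
    exacts [hz, p.start_mem_support]
  intro u w p
  induction p with
  | nil =>
    rintro rfl a q hq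
    have hab : b = a := Subtype.ext (hq _ q.end_mem_support b.2)
    exact ⟨a, Or.inr rfl, treeLE_refl hT.isTree r a, hab ▸ treeLE_refl hT.isTree r a⟩
  | @cons u c w hadj p ih =>
    intro hw a q hq
    by_cases hc : c ∈ T.verts
    · obtain ⟨z, hz, hzc, hzb⟩ := ih hw ⟨c, hc⟩ .nil (by simp)
      have hzs : (z : V) ∈ (Walk.cons hadj p).support := by
        rcases hz with hz | rfl <;> simp [*]
      have hcomp : T.TreeLE r a ⟨c, hc⟩ ∨ T.TreeLE r ⟨c, hc⟩ a := by
        refine hT.comparable_of_walk (b := ⟨c, hc⟩) (q.concat hadj) fun x hx hxT => ?_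
        rw [Walk.support_concat, List.mem_append, List.mem_singleton] at hx
        rcases hx with hx | rfl
        exacts [Or.inl (hq x hx hxT), Or.inr rfl]
      rcases hcomp with hac | hca
      · rcases hac.total_of_le hT.isTree hzc with haz | hza
        · exact ⟨a, Or.inr rfl, treeLE_refl hT.isTree r a, haz.trans hT.isTree hzb⟩
        · exact ⟨z, Or.inl hzs, hza, hzb⟩
      · exact ⟨z, Or.inl hzs, hzc.trans hT.isTree hca, hzb⟩
    · obtain ⟨z, hz, hza, hzb⟩ := ih hw a (q.concat hadj) (by
        intro x hx hxT
        rw [Walk.support_concat, List.mem_append, List.mem_singleton] at hx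
        rcases hx with hx | rfl
        exacts [hq x hx hxT, absurd hxT hc])
      refine ⟨z, ?_, hza, hzb⟩
      rcases hz with hz | rfl <;> simp [*]

/-- The natural map of end spaces of a normal tree is injective: finitely many vertices of the
tree can be separated from the rest by their finite down-closure. -/
theorem endMap_injective (hT : T.IsNormalTree r) : Function.Injective T.endMap := by
  classical
  intro ω ω' h
  induction ω using Quotient.inductionOn with | h R => ?_
  induction ω' using Quotient.inductionOn with | h S => ?_
  have hRS : (T.mapRay R).Equivalent (T.mapRay S) := Quotient.exact h
  refine Quotient.sound fun X => ?_
  have hdown : {y : T.verts | ∃ x ∈ X, T.TreeLE r y x}.Finite := by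
    have : {y : T.verts | ∃ x ∈ X, T.TreeLE r y x} = ⋃ x ∈ X, {y | T.TreeLE r y x} := by
      ext; simp
    rw [this]
    refine X.finite_toSet.biUnion fun x _ => ?_
    obtain ⟨p, hp⟩ := exists_isPath_coe hT.isTree r x
    exact (List.finite_toSet p.support).subset fun y hy => hy.mem_support hT.isTree hp
  obtain ⟨i, j, hi, hj, e⟩ := hRS (hdown.toFinset.image Subtype.val)
  have hmem := G.componentComplMk_mem hj
  rw [← e, ← SetLike.mem_coe, ComponentCompl.eq_compIn (G.componentComplMk_mem hi)] at hmem
  obtain ⟨p, hp⟩ := hmem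
  obtain ⟨z, hzp, hzR, hzS⟩ := hT.exists_le_le_mem_support (a := R.vert i) (b := S.vert j) p
  have hzX : ∀ y, T.TreeLE r z y → y ∉ X := by
    intro y hzy hyX
    refine hp z hzp ?_
    exact Finset.mem_coe.2 (Finset.mem_image.2 ⟨z, hdown.mem_toFinset.2 ⟨y, hyX, hzy⟩, rfl⟩)
  -- the part above `z` of the path in `T` from the root to `y` avoids `X`
  have hup : ∀ y, T.TreeLE r z y → y ∈ T.coe.compIn (X : Set T.verts)ᶜ z := by
    rintro y ⟨q, hq, hzq⟩
    refine ⟨q.dropUntil z hzq, fun x hx => hzX x ?_⟩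
    refine ⟨(q.takeUntil z hzq).append ((q.dropUntil z hzq).takeUntil x hx), ?_, ?_⟩
    · rw [← q.take_spec hzq, ← (q.dropUntil z hzq).take_spec hx, Walk.append_assoc] at hq
      exact hq.of_append_left
    · rw [Walk.mem_support_append_iff]
      exact Or.inl (Walk.end_mem_support _)
  have hi' := hzX _ hzR
  have hj' := hzX _ hzS
  refine ⟨i, j, hi', hj', ?_⟩
  have hmem' : S.vert j ∈ T.coe.componentComplMk hi' := by
    rw [← SetLike.mem_coe, ComponentCompl.eq_compIn (T.coe.componentComplMk_mem hi')]
    exact compIn_trans (compIn_symm (hup _ hzR)) (hup _ hzS)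
  obtain ⟨_, e'⟩ := hmem'
  exact e'.symm

end IsNormalTree

/-- The `n`-th level of the tree `T` with root `r`, as a set of vertices of `G`. -/
def level (T : G.Subgraph) (r : T.verts) (n : ℕ) : Set V :=
  {x | ∃ (v : T.verts) (p : T.coe.Walk r v), p.IsPath ∧ p.length = n ∧ (v : V) = x}

theorem iUnion_level (hT : T.coe.IsTree) (r : T.verts) : ⋃ n, T.level r n = T.verts := by
  ext x
  rw [Set.mem_iUnion]
  constructor
  · rintro ⟨n, v, -, -, -, rfl⟩
    exact v.2
  · intro hx
    obtain ⟨p, hp⟩ := exists_isPath_coe hT r ⟨x, hx⟩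
    exact ⟨p.length, ⟨x, hx⟩, p, hp, rfl, rfl⟩

/-- The levels of a normal tree are dispersed. A component of `G - X` that avoids all lower levels
contains at most one vertex of a level, since a path between two of them in this component would
contain a common lower bound. -/
theorem IsNormalTree.isDispersed_level (hT : T.IsNormalTree r) (n : ℕ) :
    G.IsDispersed (T.level r n) := by
  classical
  induction n using Nat.strong_induction_on with
  | _ n ih =>
  intro ω
  have hlow : (⋂ j ∈ Finset.range n, (T.level r j)ᶜ) ∈ ω.vertFilter :=
    (Filter.biInter_finset_mem _).2 fun j hj => ih j (Finset.mem_range.1 hj) ω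
  obtain ⟨X, hX⟩ := hlow
  have hmin : ∀ a z : T.verts, (a : V) ∈ T.level r n → (z : V) ∈ ω.component X →
      T.TreeLE r z a → z = a := by
    rintro a z ⟨a', p, hp, hlen, haa⟩ hz hza
    obtain rfl := Subtype.ext haa
    by_contra hne
    have hzp := hza.mem_support hT.isTree hp
    have hlt : (p.takeUntil z hzp).length < n := hlen ▸ p.length_takeUntil_lt_length hzp hne
    exact Set.mem_iInter₂.1 (hX hz) _ (Finset.mem_range.2 hlt) ⟨z, _, hp.takeUntil hzp, rfl, rfl⟩
  by_cases hne : ∃ a ∈ T.level r n, a ∈ ω.component X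
  · obtain ⟨a, ha, haX⟩ := hne
    filter_upwards [ω.component_mem_vertFilter X, ω.compl_mem_vertFilter {a}] with b hb hba hbn
    rw [SetLike.mem_coe, ← SetLike.mem_coe, ComponentCompl.eq_compIn haX] at hb
    obtain ⟨p, hp⟩ := hb
    obtain ⟨a', pa, hpa, hlena, rfl⟩ := id ha
    obtain ⟨b', pb, hpb, hlenb, rfl⟩ := id hbn
    obtain ⟨z, hz, hza, hzb⟩ := hT.exists_le_le_mem_support p
    have hzX : (z : V) ∈ ω.component X := by
      rw [← SetLike.mem_coe, ComponentCompl.eq_compIn haX]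
      exact support_subset_compIn p hp z hz
    apply hba
    rw [← hmin a' z ha hzX hza, ← hmin b' z hbn hzX hzb]
    simp
  · filter_upwards [ω.component_mem_vertFilter X] with b hb hbn
    exact hne ⟨b, hbn, hb⟩

end Subgraph

/-- A neighbourhood of an end `ω` contains all ends living in some `C(X, ω)`. -/
theorem EndSpace.exists_of_mem_nhds {V : Type*} {G : SimpleGraph V} {ω : G.EndSpace}
    {N : Set G.EndSpace} (hN : N ∈ 𝓝 ω) :
    ∃ X : Finset V, ∀ ω' : G.EndSpace, (ω.component X : Set V) ∈ ω'.vertFilter → ω' ∈ N := by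
  classical
  obtain ⟨O, hON, hO, hωO⟩ := mem_nhds_iff.1 hN
  suffices H : ∃ X : Finset V, ∀ ω' : G.EndSpace,
      (ω.component X : Set V) ∈ ω'.vertFilter → ω' ∈ O by
    obtain ⟨X, hX⟩ := H
    exact ⟨X, fun ω' h => hON (hX ω' h)⟩
  clear hON
  induction hO with
  | basic U hU =>
    obtain ⟨X, C, rfl⟩ := hU
    refine ⟨X, fun ω' h => ?_⟩
    obtain ⟨x, hx, hx'⟩ :=
      Filter.nonempty_of_mem (Filter.inter_mem h (ω'.component_mem_vertFilter X))
    rw [← show ω.component X = C from hωO]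
    apply SetLike.coe_injective
    rw [ComponentCompl.eq_compIn hx, ComponentCompl.eq_compIn hx']
  | univ => exact ⟨∅, fun _ _ => trivial⟩
  | inter A B _ _ ihA ihB =>
    obtain ⟨X, hX⟩ := ihA hωO.1
    obtain ⟨Y, hY⟩ := ihB hωO.2
    refine ⟨X ∪ Y, fun ω' h => ⟨hX ω' ?_, hY ω' ?_⟩⟩
    · exact Filter.mem_of_superset h (ω.component_anti Finset.subset_union_left)
    · exact Filter.mem_of_superset h (ω.component_anti Finset.subset_union_right)
  | sUnion S _ ih =>
    obtain ⟨A, hA, hωA⟩ := hωO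
    obtain ⟨X, hX⟩ := ih A hA hωA
    exact ⟨X, fun ω' h => ⟨A, hA, hX ω' h⟩⟩

theorem EndSpace.HasLocalNormalTree.exists_isCovered {V : Type*} {G : SimpleGraph V}
    {ω : G.EndSpace} (h : ω.HasLocalNormalTree) :
    ∃ X : Finset V, G.IsCovered (ω.component X : Set V) := by
  obtain ⟨T, r, hT, hN⟩ := h
  obtain ⟨X, hX⟩ := exists_of_mem_nhds hN
  refine ⟨X, T.level r, hT.isDispersed_level, fun ω' hω' => ?_⟩
  rw [Subgraph.iUnion_level hT.isTree]
  exact mem_endBoundary.1 (hX ω' hω')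

/-! ### Depth-first search trees -/

section Dfs

variable {V : Type*} (G : SimpleGraph V) (r : V) (next : V → Set V → V)

/-- The depth-first search for the vertex `z`, as seen after `k` steps: the vertex just visited
and the component in which it was chosen. The search starts at `r`; when it has visited `a` in `D`
it passes to the component `D'` of `G[D] - a` that contains `z`, and visits `next a D'`. Once `z`
itself has been visited the component is empty, and all further vertices are meaningless. -/
def dfs (z : V) : ℕ → V × Set V
  | 0 => (r, Set.univ)
  | k + 1 => (next (dfs z k).1 (G.compIn ((dfs z k).2 \ {(dfs z k).1}) z),
      G.compIn ((dfs z k).2 \ {(dfs z k).1}) z)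

/-- The vertex visited in step `k` of the depth-first search for `z`. -/
def dfsVert (z : V) (k : ℕ) : V := (dfs G r next z k).1

/-- The component in which the depth-first search for `z` chooses its `k`-th vertex. -/
def dfsComp (z : V) (k : ℕ) : Set V := (dfs G r next z k).2

/-- The depth-first search for `z` visits `z` in step `k`. -/
def DfsVisits (z : V) (k : ℕ) : Prop :=
  z ∈ dfsComp G r next z k ∧ dfsVert G r next z k = z

/-- The rule `next` continues a depth-first search at a neighbour of the last vertex. -/
def IsDfsRule : Prop :=
  ∀ (a : V) (D : Set V), (∃ w ∈ D, G.Adj a w) → next a D ∈ D ∧ G.Adj a (next a D)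

variable {G r next} {z w : V} {j k m : ℕ}

theorem dfsComp_succ (z : V) (k : ℕ) : dfsComp G r next z (k + 1) =
    G.compIn (dfsComp G r next z k \ {dfsVert G r next z k}) z := rfl

theorem dfsVert_succ (z : V) (k : ℕ) : dfsVert G r next z (k + 1) =
    next (dfsVert G r next z k) (dfsComp G r next z (k + 1)) := rfl

theorem dfsComp_succ_subset (z : V) (k : ℕ) : dfsComp G r next z (k + 1) ⊆
    dfsComp G r next z k \ {dfsVert G r next z k} := compIn_subset

theorem dfsComp_antitone (z : V) : Antitone (dfsComp G r next z) :=
  antitone_nat_of_succ_le fun k => (dfsComp_succ_subset z k).trans Set.sdiff_subset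

theorem dfsVert_notMem (h : j < k) : dfsVert G r next z j ∉ dfsComp G r next z k := fun hj =>
  (dfsComp_succ_subset z j (dfsComp_antitone z h hj)).2 rfl

theorem dfs_eq_of_mem (h : w ∈ dfsComp G r next z k) (hj : j ≤ k) :
    dfs G r next w j = dfs G r next z j := by
  replace h := dfsComp_antitone z hj h
  clear hj
  induction j with
  | zero => rfl
  | succ j ih =>
    have e := ih (dfsComp_succ_subset z j h).1
    have hc : G.compIn ((dfs G r next z j).2 \ {(dfs G r next z j).1}) w =
        G.compIn ((dfs G r next z j).2 \ {(dfs G r next z j).1}) z := compIn_eq h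
    simp only [dfs, e, hc]

theorem dfsVert_eq_of_mem (h : w ∈ dfsComp G r next z k) (hj : j ≤ k) :
    dfsVert G r next w j = dfsVert G r next z j := congrArg Prod.fst (dfs_eq_of_mem h hj)

theorem dfsComp_eq_of_mem (h : w ∈ dfsComp G r next z k) (hj : j ≤ k) :
    dfsComp G r next w j = dfsComp G r next z j := congrArg Prod.snd (dfs_eq_of_mem h hj)

theorem dfsComp_eq_compIn (hG : G.Connected) (z : V) (k : ℕ) :
    dfsComp G r next z k = G.compIn {x | ∃ j < k, x = dfsVert G r next z j}ᶜ z := by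
  induction k with
  | zero =>
    refine (Set.eq_univ_of_forall fun w => ?_).symm
    obtain ⟨p⟩ := hG.preconnected z w
    exact ⟨p, by simp⟩
  | succ k ih =>
    rw [dfsComp_succ, ih, compIn_compIn_diff]
    congr 1
    ext x
    simp only [Set.mem_sdiff, Set.mem_compl_iff, Set.mem_ofPred_eq, Set.mem_singleton_iff]
    constructor
    · rintro ⟨h1, h2⟩ ⟨j, hj, rfl⟩
      rcases Nat.lt_succ_iff_lt_or_eq.1 hj with hj | rfl
      exacts [h1 ⟨j, hj, rfl⟩, h2 rfl]
    · exact fun h => ⟨fun ⟨j, hj, e⟩ => h ⟨j, by omega, e⟩, fun e => h ⟨k, by omega, e⟩⟩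

theorem dfsVert_mem (hG : G.Connected) (hn : G.IsDfsRule next) (h : z ∈ dfsComp G r next z k) :
    dfsVert G r next z k ∈ dfsComp G r next z k ∧
      ∀ i, k = i + 1 → G.Adj (dfsVert G r next z i) (dfsVert G r next z k) := by
  induction k with
  | zero => exact ⟨trivial, by simp⟩
  | succ k ih =>
    have hz := dfsComp_succ_subset z k h
    have hmem := (ih hz.1).1
    rw [dfsComp_eq_compIn hG] at hmem
    have hconn := mem_compIn_compIn hmem
    rw [← dfsComp_eq_compIn hG] at hconn
    obtain ⟨h1, h2⟩ := hn _ (dfsComp G r next z (k + 1)) (exists_adj_mem_compIn_diff hconn hz.2)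
    refine ⟨h1, fun i hi => ?_⟩
    obtain rfl := Nat.succ_injective hi
    exact h2

theorem adj_dfsVert (hG : G.Connected) (hn : G.IsDfsRule next)
    (h : z ∈ dfsComp G r next z (k + 1)) :
    G.Adj (dfsVert G r next z k) (dfsVert G r next z (k + 1)) := (dfsVert_mem hG hn h).2 k rfl

theorem dfsVisits_dfsVert (hG : G.Connected) (hn : G.IsDfsRule next)
    (h : z ∈ dfsComp G r next z k) : DfsVisits G r next (dfsVert G r next z k) k := by
  have hmem := (dfsVert_mem hG hn h).1
  exact ⟨(dfsComp_eq_of_mem hmem le_rfl).symm ▸ hmem, dfsVert_eq_of_mem hmem le_rfl⟩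

theorem DfsVisits.mem (h : DfsVisits G r next z k) (hj : j ≤ k) : z ∈ dfsComp G r next z j :=
  dfsComp_antitone z hj h.1

theorem DfsVisits.unique (h : DfsVisits G r next z k) (h' : DfsVisits G r next z m) : k = m := by
  have key : ∀ i j, DfsVisits G r next z i → DfsVisits G r next z j → ¬ i < j := by
    intro i j hi hj hlt
    have := dfsVert_notMem (G := G) (r := r) (next := next) (z := z) hlt
    rw [hi.2] at this
    exact this hj.1
  exact le_antisymm (not_lt.1 (key m k h' h)) (not_lt.1 (key k m h h'))

/-- The depth-first search tree: its vertices are those visited by the search for them, and each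
of them is joined to the vertex visited just before. -/
def dfsTree (hG : G.Connected) (r : V) (hn : G.IsDfsRule next) : G.Subgraph where
  verts := {z | ∃ k, DfsVisits G r next z k}
  Adj x y := (∃ k, DfsVisits G r next y (k + 1) ∧ dfsVert G r next y k = x) ∨
    ∃ k, DfsVisits G r next x (k + 1) ∧ dfsVert G r next x k = y
  adj_sub := by
    rintro x y (⟨k, h, rfl⟩ | ⟨k, h, rfl⟩)
    · have := adj_dfsVert hG hn h.1
      rwa [h.2] at this
    · have := (adj_dfsVert hG hn h.1).symm
      rwa [h.2] at this
  edge_vert := by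
    rintro x y (⟨k, h, rfl⟩ | ⟨k, h, rfl⟩)
    · exact ⟨k, dfsVisits_dfsVert hG hn (h.mem (Nat.le_succ k))⟩
    · exact ⟨k + 1, h⟩
  symm := ⟨fun _ _ h => h.symm⟩

theorem dfsVisits_root (G : SimpleGraph V) (r : V) (next : V → Set V → V) :
    DfsVisits G r next r 0 := ⟨trivial, rfl⟩

/-- The root of the depth-first search tree. -/
def dfsRoot (hG : G.Connected) (r : V) (hn : G.IsDfsRule next) : (dfsTree hG r hn).verts :=
  ⟨r, 0, dfsVisits_root G r next⟩

theorem exists_isPath_dfsTree (hG : G.Connected) (r : V) (hn : G.IsDfsRule next) (k : ℕ) :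
    ∀ z : (dfsTree hG r hn).verts, DfsVisits G r next z k →
      ∃ p : (dfsTree hG r hn).coe.Walk (dfsRoot hG r hn) z, p.IsPath ∧
        ∀ x, x ∈ p.support ↔ ∃ j ≤ k, (x : V) = dfsVert G r next z j := by
  induction k with
  | zero =>
    intro z hz
    obtain rfl : dfsRoot hG r hn = z := Subtype.ext hz.2
    refine ⟨.nil, .nil, fun x => ?_⟩
    simp only [Walk.support_nil, List.mem_singleton, Nat.le_zero]
    constructor
    · rintro rfl
      exact ⟨0, rfl, rfl⟩
    · rintro ⟨_, rfl, h⟩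
      exact Subtype.ext h
  | succ k ih =>
    intro z hz
    have hy := dfsVisits_dfsVert hG hn (hz.mem (Nat.le_succ k))
    have hmem := (dfsVert_mem hG hn (hz.mem (Nat.le_succ k))).1
    obtain ⟨p, hp, hs⟩ := ih ⟨_, k, hy⟩ hy
    have hs' : ∀ x, x ∈ p.support ↔ ∃ j ≤ k, (x : V) = dfsVert G r next z j := by
      intro x
      rw [hs]
      refine exists_congr fun j => and_congr_right fun hj => ?_
      rw [dfsVert_eq_of_mem hmem hj]
    have hadj : (dfsTree hG r hn).coe.Adj ⟨_, k, hy⟩ z := Or.inl ⟨k, hz, rfl⟩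
    have hzp : z ∉ p.support := by
      rw [hs']
      rintro ⟨j, hj, e⟩
      have := (dfsVisits_dfsVert hG hn (hz.mem (hj.trans (Nat.le_succ k))))
      rw [← e] at this
      have := this.unique hz
      omega
    refine ⟨p.concat hadj, hp.concat hzp hadj, fun x => ?_⟩
    rw [Walk.support_concat, List.mem_append, List.mem_singleton, hs']
    constructor
    · rintro (⟨j, hj, e⟩ | rfl)
      exacts [⟨j, by omega, e⟩, ⟨k + 1, le_rfl, hz.2.symm⟩]
    · rintro ⟨j, hj, e⟩
      rcases Nat.le_succ_iff.1 hj with hj | rfl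
      exacts [Or.inl ⟨j, hj, e⟩, Or.inr (Subtype.ext (e.trans hz.2))]

theorem treeLE_dfsTree (hG : G.Connected) (r : V) (hn : G.IsDfsRule next)
    {x z : (dfsTree hG r hn).verts} (hz : DfsVisits G r next z k) (hj : j ≤ k)
    (hx : dfsVert G r next z j = x) : (dfsTree hG r hn).TreeLE (dfsRoot hG r hn) x z := by
  obtain ⟨p, hp, hs⟩ := exists_isPath_dfsTree hG r hn k z hz
  exact ⟨p, hp, (hs x).2 ⟨j, hj, hx.symm⟩⟩

/-- An edge of the depth-first search tree that leaves the component chosen for the vertex `y` is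
the edge from `y` to its predecessor. -/
theorem mem_dfsComp_of_adj (hG : G.Connected) (hn : G.IsDfsRule next) {a b y : V}
    (hy : DfsVisits G r next y (k + 1)) (hab : (dfsTree hG r hn).Adj a b)
    (ha : a ∈ dfsComp G r next y (k + 1)) (hne : ¬ (a = y ∧ b = dfsVert G r next y k)) :
    b ∈ dfsComp G r next y (k + 1) := by
  have hlow : ∀ m, DfsVisits G r next a m → k + 1 ≤ m := by
    intro m hm
    by_contra! hlt
    refine dfsVert_notMem (G := G) (r := r) (next := next) (z := y) hlt ?_
    rwa [← dfsVert_eq_of_mem ha hlt.le, hm.2]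
  rcases hab with ⟨m, hb, rfl⟩ | ⟨m, ha', rfl⟩
  · have hmem := (dfsVert_mem hG hn (hb.mem (Nat.le_succ m))).1
    have hkm := hlow m (dfsVisits_dfsVert hG hn (hb.mem (Nat.le_succ m)))
    rw [← dfsComp_eq_of_mem ha le_rfl, dfsComp_eq_of_mem hmem hkm]
    exact hb.mem (by omega)
  · rcases (hlow _ ha').eq_or_lt with heq | hlt
    · obtain rfl : k = m := by omega
      refine absurd ⟨?_, dfsVert_eq_of_mem ha (Nat.le_succ k)⟩ hne
      rw [← ha'.2, dfsVert_eq_of_mem ha le_rfl, hy.2]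
    · rw [← dfsComp_eq_of_mem ha le_rfl]
      exact dfsComp_antitone a (by omega) (dfsVert_mem hG hn (ha'.mem (Nat.le_succ m))).1

theorem isTree_dfsTree (hG : G.Connected) (r : V) (hn : G.IsDfsRule next) :
    (dfsTree hG r hn).coe.IsTree := by
  have hreach : ∀ z, (dfsTree hG r hn).coe.Reachable (dfsRoot hG r hn) z := by
    rintro ⟨z, k, hz⟩
    obtain ⟨p, -⟩ := exists_isPath_dfsTree hG r hn k ⟨z, k, hz⟩ hz
    exact ⟨p⟩
  have : Nonempty (dfsTree hG r hn).verts := ⟨dfsRoot hG r hn⟩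
  refine ⟨⟨fun a b => (hreach a).symm.trans (hreach b)⟩, ?_⟩
  rw [isAcyclic_iff_forall_isBridge]
  -- removing the edge from `y` to its predecessor separates the component chosen for `y`
  have key : ∀ x y : (dfsTree hG r hn).verts, ∀ k, DfsVisits G r next y (k + 1) →
      dfsVert G r next y k = x →
      ¬ ((dfsTree hG r hn).coe.deleteEdges {s(y, x)}).Reachable y x := by
    rintro x y k hy hx ⟨p⟩
    have : ∀ (a b : (dfsTree hG r hn).verts)
        (p : ((dfsTree hG r hn).coe.deleteEdges {s(y, x)}).Walk a b),
        (a : V) ∈ dfsComp G r next y (k + 1) → (b : V) ∈ dfsComp G r next y (k + 1) := by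
      intro a b p
      induction p with
      | nil => exact id
      | cons hadj _ ih =>
        intro ha
        rw [deleteEdges_adj] at hadj
        refine ih (mem_dfsComp_of_adj hG hn hy hadj.1 ha ?_)
        rintro ⟨h1, h2⟩
        obtain rfl := Subtype.ext h1
        obtain rfl := Subtype.ext (h2.trans hx)
        exact hadj.2 rfl
    exact dfsVert_notMem (Nat.lt_succ_self k) (hx ▸ this y x p hy.1)
  rintro ⟨x, y⟩ hxy
  change (dfsTree hG r hn).coe.Adj x y at hxy
  rw [show Quot.mk _ (x, y) = s(x, y) from rfl, isBridge_iff]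
  rcases id hxy with ⟨k, hy, hx⟩ | ⟨k, hx, hy⟩
  · rw [Sym2.eq_swap]
    exact fun h => key x y k hy hx h.symm
  · exact key y x k hx hy

/-- A depth-first search tree is normal: a walk from `u` to a vertex `v` that is visited later
avoids the vertices visited before `u`, and hence stays in the component chosen for `u`. -/
theorem isNormalTree_dfsTree (hG : G.Connected) (r : V) (hn : G.IsDfsRule next) :
    (dfsTree hG r hn).IsNormalTree (dfsRoot hG r hn) := by
  have key : ∀ (u v : (dfsTree hG r hn).verts) (i k : ℕ), DfsVisits G r next u i →
      DfsVisits G r next v k → i ≤ k → ∀ p : G.Walk (u : V) v,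
      (∀ x ∈ p.support, x ∈ (dfsTree hG r hn).verts → x = u ∨ x = v) →
      (dfsTree hG r hn).TreeLE (dfsRoot hG r hn) u v := by
    intro u v i k hu hv hik p hp
    have hmem : (v : V) ∈ dfsComp G r next u i := by
      rw [dfsComp_eq_compIn hG]
      refine ⟨p, ?_⟩
      rintro x hx ⟨j, hj, rfl⟩
      have hj' := dfsVisits_dfsVert hG hn (hu.mem hj.le)
      rcases hp _ hx ⟨j, hj'⟩ with e | e
      · exact hj.ne (hj'.unique (e.symm ▸ hu))
      · exact (hj.trans_le hik).ne (hj'.unique (e.symm ▸ hv))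
    exact treeLE_dfsTree hG r hn hv hik ((dfsVert_eq_of_mem hmem le_rfl).trans hu.2)
  refine ⟨isTree_dfsTree hG r hn, ?_⟩
  rintro ⟨u, i, hu⟩ ⟨v, k, hv⟩ p hp
  rcases le_total i k with hik | hki
  · exact Or.inl (key _ _ i k hu hv hik p fun x hx => (hp.meets_iff x hx).1)
  · refine Or.inr (key ⟨v, k, hv⟩ ⟨u, i, hu⟩ k i hv hu hki p.reverse fun x hx hxT => ?_)
    rw [Walk.support_reverse, List.mem_reverse] at hx
    exact ((hp.meets_iff x hx).1 hxT).symm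

/-- The depth-first search can follow an end: for every `k` it has a component after `k` steps in
which the end lives. -/
theorem exists_dfsComp_mem_vertFilter (hG : G.Connected) (ω : G.EndSpace) (k : ℕ) :
    ∃ z, z ∈ dfsComp G r next z k ∧ dfsComp G r next z k ∈ ω.vertFilter := by
  classical
  induction k with
  | zero => exact ⟨r, trivial, Filter.univ_mem⟩
  | succ k ih =>
    obtain ⟨z, -, hω⟩ := ih
    set X : Finset V := (Finset.range (k + 1)).image (dfsVert G r next z) with hX
    obtain ⟨w, hwX, hw⟩ :=
      Filter.nonempty_of_mem (Filter.inter_mem (ω.component_mem_vertFilter X) hω)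
    have hXw : {x | ∃ j < k + 1, x = dfsVert G r next w j} = (X : Set V) := by
      ext x
      simp only [hX, Set.mem_ofPred_eq, Finset.coe_image, Finset.coe_range, Set.mem_image,
        Set.mem_Iio]
      refine exists_congr fun j => and_congr_right fun hj => ?_
      rw [dfsVert_eq_of_mem hw (Nat.lt_succ_iff.1 hj), eq_comm]
    have hcomp : dfsComp G r next w (k + 1) = ω.component X := by
      rw [dfsComp_eq_compIn hG, hXw, ComponentCompl.eq_compIn hwX]
    refine ⟨w, ?_, ?_⟩ <;> rw [hcomp]
    exacts [hwX, ω.component_mem_vertFilter X]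

/-- For every end there is a depth-first ray in the search tree whose components `D k` all contain
the end. -/
theorem exists_isDepthFirst_dfsTree (hG : G.Connected) (r : V) (hn : G.IsDfsRule next)
    (ω : G.EndSpace) : ∃ (v : ℕ → V) (D : ℕ → Set V), G.IsDepthFirst v D ∧
      (∀ k, D k ∈ ω.vertFilter) ∧ (∀ k, v (k + 1) = next (v k) (D (k + 1))) ∧
      (∀ k, v k ∈ (dfsTree hG r hn).verts) ∧ ∀ k, (dfsTree hG r hn).Adj (v k) (v (k + 1)) := by
  choose z hz hω using fun k => exists_dfsComp_mem_vertFilter (r := r) (next := next) hG ω k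
  have hstep : ∀ k, dfs G r next (z (k + 1)) k = dfs G r next (z k) k := by
    intro k
    obtain ⟨x, hx, hx'⟩ := Filter.nonempty_of_mem (Filter.inter_mem (hω (k + 1)) (hω k))
    rw [← dfs_eq_of_mem hx (Nat.le_succ k), ← dfs_eq_of_mem hx' le_rfl]
  have hstepV : ∀ k, dfsVert G r next (z (k + 1)) k = dfsVert G r next (z k) k :=
    fun k => congrArg Prod.fst (hstep k)
  have hstepD : ∀ k, dfsComp G r next (z (k + 1)) k = dfsComp G r next (z k) k :=
    fun k => congrArg Prod.snd (hstep k)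
  have hvis : ∀ k, DfsVisits G r next (dfsVert G r next (z k) k) k := fun k =>
    dfsVisits_dfsVert hG hn (hz k)
  have hmem : ∀ k, dfsVert G r next (z k) k ∈ dfsComp G r next (z k) k := fun k =>
    (dfsVert_mem hG hn (hz k)).1
  refine ⟨fun k => dfsVert G r next (z k) k, fun k => dfsComp G r next (z k) k,
    ⟨rfl, hmem, fun k => ?_, fun k => ?_⟩, hω, fun k => ?_, fun k => ⟨k, hvis k⟩,
    fun k => Or.inl ⟨k, hvis (k + 1), ?_⟩⟩
  · have hm := hmem (k + 1)
    rw [dfsComp_succ, hstepD, hstepV] at hm ⊢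
    exact (compIn_eq hm).symm
  · rw [← hstepV]
    exact adj_dfsVert hG hn (hz (k + 1))
  · dsimp only
    rw [dfsVert_succ, hstepV]
  · rw [dfsVert_eq_of_mem (hmem (k + 1)) (Nat.le_succ k), hstepV]

end Dfs

/-- A depth-first ray that is guided by dispersed sets `U n` along components containing the end
`ω` belongs to `ω` if `ω` is in the closure of the union of the `U n`. A vertex `u` of `U n` is
left behind by the ray, either as a vertex of the ray or in a component that is attached to such a
vertex and contains no vertex of all `D k`. Hence no finite separator can separate almost all of
these vertices from the ray. -/
theorem IsDepthFirst.toEnd_eq {V : Type*} {G : SimpleGraph V} {v : ℕ → V} {D U : ℕ → Set V}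
    (h : G.IsDepthFirst v D) (hG : G.Connected) (hU : G.IsGuided v D U)
    (hdisp : ∀ n, G.IsDispersed (U n)) {ω : G.EndSpace} (hω : ∀ k, D k ∈ ω.vertFilter)
    (hcl : ∃ᶠ u in ω.vertFilter, u ∈ ⋃ n, U n) : h.toEnd = ω := by
  have hexh := h.exists_disjoint hG hU fun n => hdisp n h.toEnd
  refine EndSpace.ext_component fun X => ?_
  obtain ⟨K₁, hK₁⟩ := h.exists_forall_mem X
  obtain ⟨K₂, hK₂⟩ := h.eventually_mem (h.toEnd.component_mem_vertFilter X)
  obtain ⟨K, hK1, hK2⟩ : ∃ K, K₁ ≤ K ∧ K₂ ≤ K := ⟨max K₁ K₂, by simp, by simp⟩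
  obtain ⟨u, huU, huK, huX⟩ := (hcl.and_eventually
    (Filter.inter_mem (hω K) (ω.component_mem_vertFilter X))).exists
  obtain ⟨n, hn⟩ := Set.mem_iUnion.1 huU
  obtain ⟨M, hM⟩ := hexh n
  obtain ⟨j, hKj, huj, huj'⟩ := h.exists_mem_notMem_succ huK fun huM => hM ⟨u, hn, huM⟩
  have hvj := hK₂ j (hK2.trans hKj)
  have hu : u ∈ G.compIn (X : Set V)ᶜ (v j) := by
    have hvX : v j ∈ (X : Set V)ᶜ := h.toEnd.component_subset_compl X hvj
    by_cases huv : u = v j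
    · exact huv ▸ self_mem_compIn (huv ▸ hvX)
    have hsub : G.compIn (D j \ {v j}) u ⊆ (X : Set V)ᶜ := fun x hx hxX => by
      have hxj := compIn_subset hx
      have hxD := hK₁ x hxX (h.antitone (hK1.trans hKj) hxj.1) (j + 1)
      apply huj'
      rw [h.eq_compIn_of_mem j hxD]
      exact compIn_symm hx
    obtain ⟨y, hy, hjy⟩ := exists_adj_mem_compIn_diff (h.connected hG j huj (h.mem j)) huv
    refine compIn_trans (compIn_adj (self_mem_compIn hvX) hjy (hsub hy)) ?_
    have := mem_compIn_compIn (compIn_symm hy)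
    rw [compIn_eq hy] at this
    exact compIn_mono hsub this
  apply SetLike.coe_injective
  rw [ComponentCompl.eq_compIn hvj, ComponentCompl.eq_compIn huX, compIn_eq hu]

/-- The case of Jung's theorem that is needed: a connected graph that is normally covered has an
end-faithful normal tree. -/
theorem exists_isNormalTree_isEndFaithful {V : Type*} {G : SimpleGraph V} (hG : G.Connected)
    (hcov : G.IsCovered Set.univ) :
    ∃ (T : G.Subgraph) (r : T.verts), T.IsNormalTree r ∧ T.IsEndFaithful := by
  classical
  obtain ⟨U, hU, hU'⟩ := hcov
  have hrule : ∀ (a : V) (D : Set V), ∃ v, (∃ w ∈ D, G.Adj a w) → (v ∈ D ∧ G.Adj a v) ∧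
      ∀ m, (U m ∩ D).Nonempty → (∀ j < m, ¬ (U j ∩ D).Nonempty) → G.IsNearest a D (U m) v := by
    intro a D
    by_cases hD : ∃ w ∈ D, G.Adj a w
    · by_cases hm : ∃ m, (U m ∩ D).Nonempty
      · obtain ⟨v, hv⟩ := exists_isNearest (U (Nat.find hm)) hD
        refine ⟨v, fun _ => ⟨⟨hv.mem, hv.adj⟩, fun m hne hj => ?_⟩⟩
        rwa [← show Nat.find hm = m from le_antisymm (Nat.find_min' hm hne)
          (not_lt.1 fun hlt => hj _ hlt (Nat.find_spec hm))]
      · obtain ⟨v, hv⟩ := id hD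
        exact ⟨v, fun _ => ⟨hv, fun m hne => absurd ⟨m, hne⟩ hm⟩⟩
    · exact ⟨a, fun h => absurd h hD⟩
  choose next hnext using hrule
  have hn : G.IsDfsRule next := fun a D hD => (hnext a D hD).1
  obtain ⟨r⟩ := hG.nonempty
  have hT := isNormalTree_dfsTree hG r hn
  refine ⟨dfsTree hG r hn, dfsRoot hG r hn, hT, hT.endMap_injective, fun ω => ?_⟩
  obtain ⟨v, D, h, hω, hv, hvT, hadj⟩ := exists_isDepthFirst_dfsTree hG r hn ω
  have hguided : G.IsGuided v D U := fun k m _ hne hj => by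
    rw [hv k]
    exact (hnext _ _ ⟨_, h.mem (k + 1), h.adj k⟩).2 m hne hj
  let R : (dfsTree hG r hn).coe.Ray :=
    ⟨fun k => ⟨v k, hvT k⟩, fun i j hij => h.ray.injective (congrArg Subtype.val hij), hadj⟩
  exact ⟨Quotient.mk (raySetoid _) R, h.toEnd_eq hG hguided hU hω (hU' ω Filter.univ_mem)⟩

end SimpleGraph

theorem mainTheorem7 {V : Type*} (G : SimpleGraph V) (hG : G.Connected)
    (hloc : ∀ ω : G.EndSpace, ω.HasLocalNormalTree) :
    ∃ (T : G.Subgraph) (r : T.verts), T.IsNormalTree r ∧ T.IsEndFaithful :=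
  SimpleGraph.exists_isNormalTree_isEndFaithful hG
    (SimpleGraph.isCovered_univ hG fun ω => (hloc ω).exists_isCovered)
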